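/- Let $n\ge 2$. A region is a nonempty bounded open subset of $\mathbb{E}^n$ that equals the interior of its closure; let $\mathcal C$ be the set of all convex regions in $\mathbb{E}^n$. Write $d$ for Euclidean distance, $d(\mathbf p,\mathbf Q)=\inf_{\mathbf q\in\mathbf Q}d(\mathbf p,\mathbf q)$, and $v$ for $n$-dimensional volume. For $\mathbf P,\mathbf Q\in\mathcal C$ define the following distances, with values in $[0,\infty]$. - The homeomorphism distance $M(\mathbf P,\mathbf Q)=\inf_\gamma\sup_{\mathbf x\in\mathbb{E}^n}d(\mathbf x,\gamma(\mathbf x))$, where $\gamma$ ranges over the homeomorphisms of $\mathbb{E}^n$ onto itself with $\gamma(\mathbf P)=\mathbf Q$. - The Hausdorff distance $H(\mathbf P,\mathbf Q)=\max\bigl(\sup_{\mathbf p\in\mathbf P}d(\mathbf p,\mathbf Q),\ \sup_{\mathbf q\in\mathbf Q}d(\mathbf q,\mathbf P)\bigr)$. - The dual-Hausdorff distance $H^d(\mathbf P,\mathbf Q)=\max\bigl(H(\mathbf P,\mathbf Q),H(\mathbf Q^c,\mathbf P^c)\bigr)$. - The symmetric-difference distance $V(\mathbf P,\mathbf Q)=v\bigl((\mathbf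 P\setminus\mathbf Q)\cup(\mathbf Q\setminus\mathbf P)\bigr)$. - For each Mulholland function $\psi$, the Wasserstein distance $$W^\psi(\mathbf P,\mathbf Q)=\inf_\gamma\ \psi^{-1}\Bigl(\frac1{v(\mathbf P)}\int_{\mathbf P}\psi\bigl(d(\mathbf x,\gamma(\mathbf x))\bigr)\,d\mathbf x\Bigr),$$ where $\gamma$ ranges over the measurable maps $\mathbb{E}^n\to\mathbb{E}^n$ that push the uniform distribution over $\mathbf P$ forward to the uniform distribution over $\mathbf Q$. Here a Mulholland function is a continuous strictly increasing $\psi:[0,\infty)\to[0,\infty)$ with $\psi(0)=0$, $\lim_{x\to\infty}\psi(x)=\infty$ and, for all $m$ and all $x_i,y_i\ge0$, $$\psi^{-1}\Bigl(\sum_{i=1}^m\psi(x_i+y_i)\Bigr)\le\psi^{-1}\Bigl(\sum_{i=1}^m\psi(x_i)\Bigr)+\psi^{-1}\Bigl(\sum_{i=1}^m\psi(y_i)\Bigr).$$ For a distance $\mu$, let $\mathcal B_\mu(\mathbf P,r)=\{\mathbf Q\in\mathcal C:\mu(\mathbf P,\mathbf Q)<r\}$; the topology on $\mathcal C$ generated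 by $\mu$ consists of those $\mathcal U\subseteq\mathcal C$ such that for every $\mathbf P\in\mathcal U$ there is $r>0$ with $\mathcal B_\mu(\mathbf P,r)\subseteq\mathcal U$. Then $M$, $H$, $H^d$, $V$ and, for every Mulholland function $\psi$, $W^\psi$ all generate the same topology on $\mathcal C$. Moreover, each ball $\mathcal B_{W^\psi}(\mathbf P,r)$ with $r>0$ is a neighbourhood of $\mathbf P$ in this topology. -/

import Mathlib

open MeasureTheory
open scoped ENNReal NNReal Topology

noncomputable section

namespace Shape

/-- `n`-dimensional Euclidean space. -/
abbrev E (n : ℕ) : Type := EuclideanSpace ℝ (Fin n)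

/-- A region: a nonempty bounded open subset of `E n` equal to the interior of its closure. -/
structure Region (n : ℕ) where
  carrier : Set (E n)
  nonempty : carrier.Nonempty
  isOpen : IsOpen carrier
  isBounded : Bornology.IsBounded carrier
  regular : interior (closure carrier) = carrier

/-- The space of convex regions. -/
abbrev ConvexRegion (n : ℕ) : Type := {P : Region n // Convex ℝ P.carrier}

/-! ### The topology generated by a distance function -/

/-- The open ball of radius `r` centred at `P`, for a distance function `μ`. -/
def ball {X : Type*} (μ : X → X → ℝ≥0∞) (P : X) (r : ℝ≥0∞) : Set X := {Q | μ P Q < r}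

/-- The topology generated by a distance function: a set is open if and only if it contains a
ball of positive radius around each of its points. -/
@[reducible] def distTopology {X : Type*} (μ : X → X → ℝ≥0∞) : TopologicalSpace X where
  IsOpen U := ∀ P ∈ U, ∃ r, 0 < r ∧ ball μ P r ⊆ U
  isOpen_univ _ _ := ⟨1, one_pos, Set.subset_univ _⟩
  isOpen_inter U V hU hV P hP := by
    obtain ⟨r, hr, h⟩ := hU P hP.1
    obtain ⟨s, hs, h'⟩ := hV P hP.2
    exact ⟨min r s, lt_min hr hs, fun Q (hQ : μ P Q < min r s) =>
      ⟨h (lt_of_lt_of_le hQ (min_le_left r s)), h' (lt_of_lt_of_le hQ (min_le_right r s))⟩⟩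
  isOpen_sUnion S hS P hP := by
    obtain ⟨U, hU, hPU⟩ := hP
    obtain ⟨r, hr, h⟩ := hS U hU P hPU
    exact ⟨r, hr, fun Q hQ => ⟨U, hU, h hQ⟩⟩

/-- For a (pseudo, extended) metric this is the usual metric topology. -/
theorem distTopology_edist {X : Type*} [PseudoEMetricSpace X] :
    distTopology (fun P Q : X => edist P Q) = (inferInstance : TopologicalSpace X) := by
  ext U
  rw [EMetric.isOpen_iff]
  have hb : ∀ (P : X) (r : ℝ≥0∞), ball (fun P Q : X => edist P Q) P r = Metric.eball P r := by
    intro P r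
    ext Q
    simp only [ball, Set.mem_ofPred_eq, Metric.mem_eball, edist_comm]
  show (∀ P ∈ U, ∃ r, 0 < r ∧ ball (fun P Q : X => edist P Q) P r ⊆ U) ↔ _
  simp only [hb, gt_iff_lt]

/-- The topology on the space of convex regions generated by a distance between regions. -/
@[reducible] def convexTopology {n : ℕ} (μ : Region n → Region n → ℝ≥0∞) :
    TopologicalSpace (ConvexRegion n) :=
  distTopology fun P Q => μ P.1 Q.1

/-! ### The distances between regions -/

variable {n : ℕ}

/-- The homeomorphism distance `M`; it is `∞` if no homeomorphism of the space maps `A` onto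
`B`. -/
def homeoDist (A B : Region n) : ℝ≥0∞ :=
  ⨅ (γ : E n ≃ₜ E n) (_ : γ '' A.carrier = B.carrier), ⨆ x : E n, edist x (γ x)

/-- The Hausdorff distance `H`. -/
def hausdorff (P Q : Region n) : ℝ≥0∞ :=
  Metric.hausdorffEDist P.carrier Q.carrier

/-- The dual-Hausdorff distance `H^d`. -/
def dualHausdorff (P Q : Region n) : ℝ≥0∞ :=
  max (hausdorff P Q) (Metric.hausdorffEDist Q.carrierᶜ P.carrierᶜ)

/-- The symmetric-difference distance `V`. -/
def symmDiffDist (P Q : Region n) : ℝ≥0∞ :=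
  volume ((P.carrier \ Q.carrier) ∪ (Q.carrier \ P.carrier))

/-- Mulholland functions `ψ : [0, ∞) → [0, ∞)`. The other conditions make `ψ` a bijection, so
that `Function.invFun ψ` is its inverse. -/
structure IsMulholland (ψ : ℝ≥0 → ℝ≥0) : Prop where
  continuous : Continuous ψ
  strictMono : StrictMono ψ
  map_zero : ψ 0 = 0
  tendsto : Filter.Tendsto ψ Filter.atTop Filter.atTop
  mulholland : ∀ (m : ℕ) (x y : Fin m → ℝ≥0),
    Function.invFun ψ (∑ i, ψ (x i + y i)) ≤
      Function.invFun ψ (∑ i, ψ (x i)) + Function.invFun ψ (∑ i, ψ (y i))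

/-- The inverse of `ψ`, extended by `∞ ↦ ∞`. -/
def psiInv (ψ : ℝ≥0 → ℝ≥0) (s : ℝ≥0∞) : ℝ≥0∞ :=
  if s = ∞ then ∞ else (Function.invFun ψ s.toNNReal : ℝ≥0)

/-- The transport cost `I(γ) = ∫ ψ(d(x, γ(x))) dθ(x)`. -/
def transportCost (ψ : ℝ≥0 → ℝ≥0) (θ : Measure (E n)) (γ : E n → E n) : ℝ≥0∞ :=
  ∫⁻ x, (ψ (nndist x (γ x)) : ℝ≥0∞) ∂θ

/-- The Wasserstein distance of two distributions: the infimum of `ψ⁻¹(I(γ))` over all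
measurable maps `γ` that transport `θ` to `ζ`. -/
def wassersteinMeasure (ψ : ℝ≥0 → ℝ≥0) (θ ζ : Measure (E n)) : ℝ≥0∞ :=
  ⨅ (γ : E n → E n) (_ : Measurable γ ∧ θ.map γ = ζ), psiInv ψ (transportCost ψ θ γ)

/-- The uniform distribution over a region: normalized Lebesgue measure on it. -/
def uniformDist (P : Region n) : Measure (E n) :=
  ProbabilityTheory.cond volume P.carrier

/-- The Wasserstein distance `W^ψ` of two regions. -/
def wasserstein (ψ : ℝ≥0 → ℝ≥0) (P Q : Region n) : ℝ≥0∞ :=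
  wassersteinMeasure ψ (uniformDist P) (uniformDist Q)

end Shape

end

namespace Shape

/-! ### Transport maps between measures on standard Borel spaces -/

/-! All the distances are compared with one relation. After a translation `P` contains the origin,
and `Near η P Q` squeezes `Q` between two dilates of `P`. A distance is `IsNearCompatible` if small
distance from `P` forces `Near η P Q`, and `Near η P Q` for small `η` forces small distance. Two
such distances have interleaved balls around every centre, hence the same topology.

That small distance forces nearness rests on `near_or_exists_ball_far`: if `Q` is not near `P`, one
of the two sets contains a ball, of radius fixed by `P` and `η`, that stays at least that radius
away from the other. Such a ball bounds H and V from below, hence also M and H^d, since H ≤ H^d ≤ M.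
It bounds W^ψ as well, because its mass must travel at least the radius; when the ball lies in `Q`,
its mass is controlled through the volume bound `volume_le_of_transportCost_lt`.

Conversely, for near sets `radialShift` is a homeomorphism of the space with displacement at most `η
* R`, which handles M, H^d and H. V is at most the volume of the shell between the dilates. For W^ψ,
dilate `P` to the volume of `Q`, then rearrange only the part outside `Q`: little mass moves, and by
a bounded distance. The rearrangement exists because an atomless distribution can be sent to any
other by way of the uniform distribution on the unit interval.

Balls of W^ψ are neighbourhoods because each contains a Hausdorff ball, which is open by the
triangle inequality. -/

open ProbabilityTheory Set Filter in
/-- The distribution function of an atomless probability measure is continuous. -/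
theorem continuous_cdf (μ : Measure ℝ) [IsProbabilityMeasure μ] [NullSingletonClass μ] :
    Continuous (cdf μ) := by
  rw [continuous_iff_continuousAt]
  intro x
  rw [(monotone_cdf μ).continuousAt_iff_leftLim_eq_rightLim, (cdf μ).rightLim_eq]
  have h := (cdf μ).measure_singleton x
  rw [measure_cdf, measure_singleton] at h
  have h1 := ENNReal.ofReal_eq_zero.1 h.symm
  exact le_antisymm ((monotone_cdf μ).leftLim_le le_rfl) (by linarith)

open ProbabilityTheory Set Filter in
/-- The distribution function of an atomless probability measure on `ℝ` maps it to the uniform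
distribution on the unit interval. -/
theorem exists_measurable_map_eq_volume_unitInterval (μ : Measure ℝ) [IsProbabilityMeasure μ]
    [NullSingletonClass μ] : ∃ F : ℝ → unitInterval, Measurable F ∧ μ.map F = volume := by
  have hmeas : Measurable (cdf μ) := (monotone_cdf μ).measurable
  have hF : Measurable fun t : ℝ =>
      (⟨cdf μ t, cdf_nonneg μ t, cdf_le_one μ t⟩ : unitInterval) := hmeas.subtype_mk
  have hsurj : ∀ x : ℝ, 0 < x → x < 1 → ∃ a, cdf μ a = x := fun x h0 h1 =>
    mem_range_of_exists_le_of_exists_ge (continuous_cdf μ)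
      ((tendsto_cdf_atBot μ).eventually_le_const h0).exists
      ((tendsto_cdf_atTop μ).eventually_const_le h1).exists
  have hle : ∀ x : ℝ, 0 < x → x < 1 → ENNReal.ofReal x ≤ μ {t | cdf μ t ≤ x} := by
    intro x h0 h1
    obtain ⟨a, rfl⟩ := hsurj x h0 h1
    rw [ofReal_cdf]
    exact measure_mono fun t ht => monotone_cdf μ ht
  -- The cdf may be constant to the right of `a`, so only the strict sublevel set lies in `Iic a`;
  -- the non-strict one is recovered below by letting `ε` tend to 0.
  have hlt : ∀ x : ℝ, 0 < x → x < 1 → μ {t | cdf μ t < x} ≤ ENNReal.ofReal x := by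
    intro x h0 h1
    obtain ⟨a, rfl⟩ := hsurj x h0 h1
    rw [ofReal_cdf]
    exact measure_mono fun t ht => ((monotone_cdf μ).reflect_lt ht).le
  refine ⟨_, hF, ?_⟩
  have := Measure.isProbabilityMeasure_map (μ := μ) hF.aemeasurable
  refine Measure.ext_of_Iic _ _ fun x => ?_
  rw [Measure.map_apply hF measurableSet_Iic, unitInterval.volume_Iic]
  have hpre : (fun t : ℝ => (⟨cdf μ t, cdf_nonneg μ t, cdf_le_one μ t⟩ : unitInterval)) ⁻¹'
      Iic x = {t | cdf μ t ≤ x} := rfl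
  rw [hpre]
  rcases x.2.2.eq_or_lt with h1 | h1
  · simp [h1, cdf_le_one]
  apply le_antisymm
  · refine ENNReal.le_of_forall_pos_le_add fun ε hε _ => ?_
    have hadd : ENNReal.ofReal (x + ε) = ENNReal.ofReal x + ε := by
      rw [ENNReal.ofReal_add x.2.1 ε.coe_nonneg, ENNReal.ofReal_coe_nnreal]
    rw [← hadd]
    by_cases hy : (x : ℝ) + ε < 1
    · refine (measure_mono fun t ht => ?_).trans (hlt (x + ε) ?_ hy)
      · exact lt_of_le_of_lt (show cdf μ t ≤ x from ht) (by simpa using hε)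
      · exact add_pos_of_nonneg_of_pos x.2.1 hε
    · refine prob_le_one.trans ?_
      rw [← ENNReal.ofReal_one]
      exact ENNReal.ofReal_le_ofReal (not_lt.1 hy)
  · rcases x.2.1.eq_or_lt with h0 | h0
    · simp [← h0]
    · exact hle x h0 h1

/-- An atomless probability measure on a standard Borel space can be transported to every
probability measure on a standard Borel space. -/
theorem exists_measurable_map_eq {X Y : Type*} [MeasurableSpace X] [StandardBorelSpace X]
    [MeasurableSpace Y] [StandardBorelSpace Y] [Nonempty Y]
    (μ : Measure X) (ν : Measure Y) [IsProbabilityMeasure μ] [IsProbabilityMeasure ν]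
    [NullSingletonClass μ] : ∃ T : X → Y, Measurable T ∧ μ.map T = ν := by
  have he := measurableEmbedding_embeddingReal X
  have := Measure.isProbabilityMeasure_map (μ := μ) he.measurable.aemeasurable
  have : NullSingletonClass (μ.map (embeddingReal X)) := ⟨fun x => by
    rw [Measure.map_apply he.measurable (measurableSet_singleton x)]
    exact Set.Subsingleton.measure_zero (Set.subsingleton_singleton.preimage he.injective) μ⟩
  obtain ⟨F, hF, hFμ⟩ := exists_measurable_map_eq_volume_unitInterval (μ.map (embeddingReal X))
  obtain ⟨G, hG, hGν⟩ := Measure.exists_measurable_map_eq ν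
  refine ⟨G ∘ F ∘ embeddingReal X, hG.comp (hF.comp he.measurable), ?_⟩
  rw [← Measure.map_map hG (hF.comp he.measurable), ← Measure.map_map hF he.measurable, hFμ, hGν]

/-- Sets of the same finite measure can be transported to each other. -/
theorem exists_measurable_map_restrict_eq {X : Type*} [MeasurableSpace X] [StandardBorelSpace X]
    (μ : Measure X) [NullSingletonClass μ] {A B : Set X} (h : μ A = μ B) (hA : μ A ≠ ∞) :
    ∃ T : X → X, Measurable T ∧ (μ.restrict A).map T = μ.restrict B := by
  by_cases h0 : μ A = 0
  · refine ⟨id, measurable_id, ?_⟩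
    rw [Measure.map_id, Measure.restrict_eq_zero.2 h0, Measure.restrict_eq_zero.2 (h ▸ h0)]
  have hB0 : μ B ≠ 0 := h ▸ h0
  have hB : μ B ≠ ∞ := h ▸ hA
  have : Nonempty X := (nonempty_of_measure_ne_zero h0).to_type
  have := ProbabilityTheory.cond_isProbabilityMeasure_of_finite h0 hA
  have := ProbabilityTheory.cond_isProbabilityMeasure_of_finite hB0 hB
  have : NullSingletonClass (ProbabilityTheory.cond μ A) := ⟨fun x => by
    simp [ProbabilityTheory.cond]⟩
  obtain ⟨T, hT, hTμ⟩ := exists_measurable_map_eq (ProbabilityTheory.cond μ A)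
    (ProbabilityTheory.cond μ B)
  refine ⟨T, hT, ?_⟩
  simp only [ProbabilityTheory.cond, Measure.map_smul, h] at hTμ
  have := congrArg (fun ν => μ B • ν) hTμ
  simpa [smul_smul, ENNReal.mul_inv_cancel hB0 hB] using this

variable {n : ℕ}

/-! ### Convex sets squeezed between two dilates of a convex set -/

/-- `Q` lies between the dilates of `P` by the factors `1 - η` and `1 + η`. -/
def Near (η : ℝ) (P Q : Set (E n)) : Prop :=
  (fun x => (1 - η) • x) '' P ⊆ Q ∧ Q ⊆ (fun x => (1 + η) • x) '' P

/-- Every point of `A` has distance at least `ρ` from every point of `B`. -/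
def Far (ρ : ℝ) (A B : Set (E n)) : Prop := ∀ a ∈ A, ∀ b ∈ B, ρ ≤ dist a b

/-! ### Gauge estimates and separation by a ball -/

theorem absorbent_of_ball_subset {r : ℝ} {P : Set (E n)} (hr : 0 < r)
    (h : Metric.ball 0 r ⊆ P) : Absorbent ℝ P :=
  absorbent_nhds_zero (Filter.mem_of_superset (Metric.ball_mem_nhds 0 hr) h)

theorem gauge_lt_one_iff {r : ℝ} {P : Set (E n)} (hP : Convex ℝ P) (hPo : IsOpen P) (hr : 0 < r)
    (h : Metric.ball 0 r ⊆ P) {x : E n} : gauge P x < 1 ↔ x ∈ P := by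
  rw [gauge_lt_one_iff_mem_interior hP
    (Filter.mem_of_superset (Metric.ball_mem_nhds 0 hr) h), hPo.interior_eq]

/-- The gauge of `P` is Lipschitz with constant `1 / r` if `P` contains the ball of radius `r`. -/
theorem gauge_sub_gauge_le {r : ℝ} {P : Set (E n)} (hP : Convex ℝ P) (hr : 0 < r)
    (h : Metric.ball 0 r ⊆ P) (x y : E n) : r * (gauge P x - gauge P y) ≤ dist x y := by
  have h1 := gauge_add_le hP (absorbent_of_ball_subset hr h) (x - y) y
  have h2 := mul_gauge_le_norm (x := x - y) h
  rw [sub_add_cancel] at h1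
  rw [dist_eq_norm]
  nlinarith

/-- A point that does not belong to the open convex set `Q` is close to the centre of a ball
that is far from `Q`. -/
theorem exists_ball_far {Q : Set (E n)} (hQ : Convex ℝ Q) (hQo : IsOpen Q) {x : E n} (hx : x ∉ Q)
    {ρ : ℝ} (hρ : 0 < ρ) :
    ∃ y, Metric.ball y ρ ⊆ Metric.ball x (3 * ρ) ∧ Far ρ (Metric.ball y ρ) Q := by
  rcases Q.eq_empty_or_nonempty with rfl | ⟨q₀, hq₀⟩
  · exact ⟨x, Metric.ball_subset_ball (by linarith), by simp [Far]⟩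
  obtain ⟨f, hf⟩ := geometric_hahn_banach_open_point hQ hQo hx
  set v := (InnerProductSpace.toDual ℝ (E n)).symm f with hv
  have hfv : ∀ z, f z = inner ℝ v z := fun z => by
    rw [hv, InnerProductSpace.toDual_symm_apply]
  have hv0 : v ≠ 0 := by
    intro h0
    have := hf q₀ hq₀
    simp [hfv, h0] at this
  have hvn : 0 < ‖v‖ := norm_pos_iff.2 hv0
  have hnorm : ‖(2 * ρ / ‖v‖) • v‖ = 2 * ρ := by
    rw [norm_smul, Real.norm_of_nonneg (by positivity)]
    field_simp
  -- Step 2ρ from `x` along the normal of the separating hyperplane: the ball of radius ρ there is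
  -- still ρ beyond the hyperplane and within 3ρ of `x`.
  refine ⟨x + (2 * ρ / ‖v‖) • v, Metric.ball_subset_ball' ?_, ?_⟩
  · rw [dist_eq_norm, add_sub_cancel_left, hnorm]
    linarith
  · intro z hz q hq
    have h1 : inner ℝ v (z - q) ≤ ‖v‖ * dist z q := by
      rw [dist_eq_norm]
      exact real_inner_le_norm v (z - q)
    have h2 : -(‖v‖ * ρ) ≤ inner ℝ v (z - (x + (2 * ρ / ‖v‖) • v)) := by
      have h3 := abs_real_inner_le_norm v (z - (x + (2 * ρ / ‖v‖) • v))
      rw [Metric.mem_ball, dist_eq_norm] at hz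
      have := mul_le_mul_of_nonneg_left hz.le hvn.le
      linarith [neg_abs_le (inner ℝ v (z - (x + (2 * ρ / ‖v‖) • v)))]
    have h4 : inner ℝ v q < inner ℝ v x := by
      rw [← hfv, ← hfv]
      exact hf q hq
    have h5 : inner ℝ v ((2 * ρ / ‖v‖) • v) = 2 * ρ * ‖v‖ := by
      rw [inner_smul_right, real_inner_self_eq_norm_sq]
      field_simp
    rw [inner_sub_right] at h1
    rw [inner_sub_right, inner_add_right, h5] at h2
    have h6 : ‖v‖ * ρ ≤ ‖v‖ * dist z q := by linarith
    exact le_of_mul_le_mul_left h6 hvn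

/-- The dilate by `1 - t` of a convex set that contains the ball of radius `r` lies at depth
`t * r`. -/
theorem ball_smul_subset {r t : ℝ} {P : Set (E n)} (hP : Convex ℝ P)
    (h : Metric.ball 0 r ⊆ P) (ht0 : 0 < t) (ht1 : t ≤ 1) {p : E n} (hp : p ∈ P) :
    Metric.ball ((1 - t) • p) (t * r) ⊆ P := by
  intro z hz
  have h1 : t⁻¹ • (z - (1 - t) • p) ∈ P := by
    apply h
    rw [mem_ball_zero_iff, norm_smul, Real.norm_of_nonneg (by positivity), ← dist_eq_norm,
      inv_mul_lt_iff₀ ht0]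
    exact hz
  have h2 := hP hp h1 (sub_nonneg.2 ht1) ht0.le (by ring)
  rwa [smul_smul, mul_inv_cancel₀ ht0.ne', one_smul, add_sub_cancel] at h2

/-- If `Q` is not near `P`, then one of the two sets contains a ball, of a radius that does not
depend on `Q`, which is far from the other set. -/
theorem near_or_exists_ball_far {r η : ℝ} {P Q : Set (E n)} (hP : Convex ℝ P) (hPo : IsOpen P)
    (hr : 0 < r) (hPr : Metric.ball 0 r ⊆ P) (hQ : Convex ℝ Q) (hQo : IsOpen Q) (hη : 0 < η)
    (hη' : η ≤ 1 / 2) :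
    Near η P Q ∨ ∃ y, (Metric.ball y (η * r / 8) ⊆ P ∧ Far (η * r / 8) (Metric.ball y (η * r / 8)) Q)
      ∨ (Metric.ball y (η * r / 8) ⊆ Q ∧ Far (η * r / 8) (Metric.ball y (η * r / 8)) P) := by
  have hρ : 0 < η * r / 8 := by positivity
  have hrη : 0 < η * r := by positivity
  by_cases hin : (fun x => (1 - η) • x) '' P ⊆ Q
  swap
  · right
    obtain ⟨_, ⟨p, hp, rfl⟩, hx⟩ := Set.not_subset.1 hin
    obtain ⟨y, hy, hf⟩ := exists_ball_far hQ hQo hx hρ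
    exact ⟨y, Or.inl ⟨hy.trans ((Metric.ball_subset_ball (by linarith)).trans
      (ball_smul_subset hP hPr hη (by linarith) hp)), hf⟩⟩
  by_cases hout : Q ⊆ (fun x => (1 + η) • x) '' P
  · exact Or.inl ⟨hin, hout⟩
  right
  -- `Q` contains the dilate of `P` by `1 - η ≥ 1/2`, hence half of the ball.
  have hQr : Metric.ball 0 (r / 2) ⊆ Q := by
    intro z hz
    rw [mem_ball_zero_iff] at hz
    refine hin ⟨(1 - η)⁻¹ • z, hPr ?_, ?_⟩
    · rw [mem_ball_zero_iff, norm_smul, Real.norm_of_nonneg (by simp; linarith),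
        inv_mul_lt_iff₀ (by linarith)]
      nlinarith
    · simp only
      rw [smul_smul, mul_inv_cancel₀ (by linarith), one_smul]
  obtain ⟨q, hq, hqP⟩ := Set.not_subset.1 hout
  have hg : 1 + η ≤ gauge P q := le_gauge_of_notMem
    (hP.starConvex (hPr (Metric.mem_ball_self hr))) (absorbent_of_ball_subset hr hPr _) hqP
  have hg0 : 0 < gauge P q := by linarith
  have hq' : ((1 + η) / gauge P q) • q ∈ Q :=
    hQ.smul_mem_of_zero_mem (hQr (Metric.mem_ball_self (by positivity))) hq
      ⟨by positivity, (div_le_one hg0).2 hg⟩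
  have hgq' : gauge P (((1 + η) / gauge P q) • q) = 1 + η := by
    rw [gauge_smul_of_nonneg (by positivity), smul_eq_mul, div_mul_cancel₀ _ hg0.ne']
  generalize ((1 + η) / gauge P q) • q = q' at hq' hgq'
  -- Shrinking by `1 - η/4` buys depth `(η/4) * (r/2)` in `Q` and leaves the `P`-gauge at least `1 +
  -- 5η/8`. Over the ball the gauge drops by at most `η/8`, so it stays above `1 + η/2`, at distance
  -- at least `r * η/2` from `P`.
  refine ⟨(1 - η / 4) • q', Or.inr ⟨?_, ?_⟩⟩
  · have := ball_smul_subset hQ hQr (t := η / 4) (by positivity) (by linarith) hq'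
    rwa [show η / 4 * (r / 2) = η * r / 8 by ring] at this
  · intro z hz p hp
    have h1 := gauge_sub_gauge_le hP hr hPr z p
    have h2 := gauge_sub_gauge_le hP hr hPr ((1 - η / 4) • q') z
    rw [gauge_smul_of_nonneg (by linarith), smul_eq_mul, hgq'] at h2
    rw [Metric.mem_ball, dist_comm] at hz
    have h3 := (gauge_lt_one_iff hP hPo hr hPr).2 hp
    nlinarith [mul_pos hr (sub_pos.2 h3), mul_nonneg hrη.le (sub_nonneg.2 hη')]

theorem Near.gauge_le {r η : ℝ} {P Q : Set (E n)} (h : Near η P Q) (hr : 0 < r)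
    (hQr : Metric.ball 0 r ⊆ Q) (hη : 0 < η) (x : E n) : gauge P x ≤ (1 + η) * gauge Q x := by
  refine le_of_forall_pos_le_add fun ε hε => ?_
  obtain ⟨b, hb0, hb, q, hq, rfl⟩ := exists_lt_of_gauge_lt (absorbent_of_ball_subset hr hQr)
    (show gauge Q x < gauge Q x + ε / (1 + η) by
      have : 0 < ε / (1 + η) := by positivity
      linarith)
  obtain ⟨p, hp, rfl⟩ := h.2 hq
  simp only at hb ⊢
  have h1 : gauge P (b • (1 + η) • p) ≤ b * (1 + η) := by
    rw [smul_smul]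
    exact gauge_le_of_mem (by positivity) (Set.smul_mem_smul_set hp)
  have h2 := mul_lt_mul_of_pos_right hb (show 0 < 1 + η by positivity)
  rw [add_mul, div_mul_cancel₀ _ (by positivity)] at h2
  linarith

theorem Near.le_gauge {r η : ℝ} {P Q : Set (E n)} (h : Near η P Q) (hr : 0 < r)
    (hPr : Metric.ball 0 r ⊆ P) (hη : η < 1) (x : E n) :
    (1 - η) * gauge Q x ≤ gauge P x := by
  have hη' := sub_pos.2 hη
  refine le_of_forall_pos_le_add fun ε hε => ?_
  obtain ⟨b, hb0, hb, p, hp, rfl⟩ := exists_lt_of_gauge_lt (absorbent_of_ball_subset hr hPr)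
    (show gauge P x < gauge P x + ε by linarith)
  simp only at hb ⊢
  have h1 : gauge Q ((1 - η) • b • p) ≤ b := by
    rw [smul_comm]
    exact gauge_le_of_mem hb0.le (Set.smul_mem_smul_set (h.1 ⟨p, hp, rfl⟩))
  rw [gauge_smul_of_nonneg hη'.le, smul_eq_mul] at h1
  linarith

theorem Near.ball_subset {r η : ℝ} {P Q : Set (E n)} (h : Near η P Q)
    (hPr : Metric.ball 0 r ⊆ P) (hη : η < 1) : Metric.ball 0 ((1 - η) * r) ⊆ Q := by
  have hη' := sub_pos.2 hη
  intro z hz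
  rw [mem_ball_zero_iff] at hz
  refine h.1 ⟨(1 - η)⁻¹ • z, hPr ?_, ?_⟩
  · rwa [mem_ball_zero_iff, norm_smul, Real.norm_of_nonneg (by positivity), inv_mul_lt_iff₀ hη']
  · simp only
    rw [smul_smul, mul_inv_cancel₀ hη'.ne', one_smul]

/-! ### A homeomorphism of the space that maps one convex set onto another -/

/-- The map that fixes the rays from the origin, is linear on the intersection of each ray
with `P`, and is a translation on the rest of the ray. -/
noncomputable def radialShift (P Q : Set (E n)) (x : E n) : E n :=
  x + (max 1 (gauge P x))⁻¹ • (gaugeRescale P Q x - x)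

theorem radialShift_eq_smul (P Q : Set (E n)) (x : E n) :
    radialShift P Q x = (1 + (max 1 (gauge P x))⁻¹ * (gauge P x / gauge Q x - 1)) • x := by
  rw [radialShift, gaugeRescale_def, add_smul, one_smul, mul_smul, sub_smul, one_smul]

theorem radialShift_factor_of_le {p q : ℝ} (hp1 : p ≤ 1) :
    1 + (max 1 p)⁻¹ * (p / q - 1) = p / q := by
  rw [max_eq_left hp1]
  ring

theorem radialShift_factor_of_ge {p q : ℝ} (hp1 : 1 ≤ p) :
    1 + (max 1 p)⁻¹ * (p / q - 1) = 1 + q⁻¹ - p⁻¹ := by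
  have : p ≠ 0 := by positivity
  rw [max_eq_right hp1, mul_sub, ← mul_div_assoc, inv_mul_cancel₀ this, one_div, mul_one]
  ring

/-- Positivity keeps every point on its own open ray, so gauges scale by the same factor. -/
theorem radialShift_factor_pos {p q : ℝ} (hp : 0 < p) (hq : 0 < q) :
    0 < 1 + (max 1 p)⁻¹ * (p / q - 1) := by
  rcases le_total p 1 with h | h
  · rw [radialShift_factor_of_le h]
    positivity
  · rw [radialShift_factor_of_ge h]
    have := inv_le_one_of_one_le₀ h
    have : 0 < q⁻¹ := by positivity
    linarith

theorem gauge_radialShift {P Q : Set (E n)} {x : E n} (hp : 0 < gauge P x) (hq : 0 < gauge Q x) :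
    gauge Q (radialShift P Q x) =
      (1 + (max 1 (gauge P x))⁻¹ * (gauge P x / gauge Q x - 1)) * gauge Q x := by
  rw [radialShift_eq_smul, gauge_smul_of_nonneg (radialShift_factor_pos hp hq).le, smul_eq_mul]

/-- On each ray the map is linear up to the boundary of `P`, which goes to the boundary of `Q`, and
a translation beyond it. Exchanging `P` and `Q` reverses both pieces. -/
theorem radialShift_radialShift {P Q : Set (E n)} {x : E n} (hp : 0 < gauge P x)
    (hq : 0 < gauge Q x) : radialShift Q P (radialShift P Q x) = x := by
  rw [radialShift_eq_smul Q P, gauge_radialShift hp hq, radialShift_eq_smul,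
    gauge_smul_of_nonneg (radialShift_factor_pos hp hq).le, smul_eq_mul, smul_smul]
  convert one_smul ℝ x
  generalize gauge P x = p at *
  generalize gauge Q x = q at *
  rcases le_total p 1 with h | h
  · rw [radialShift_factor_of_le h, div_mul_cancel₀ _ hq.ne', radialShift_factor_of_le h]
    field_simp
  · rw [radialShift_factor_of_ge h]
    have hc : 0 < 1 + q⁻¹ - p⁻¹ := by
      have := radialShift_factor_pos hp hq
      rwa [radialShift_factor_of_ge h] at this
    -- The image of a point with `P`-gauge at least 1 has `Q`-gauge at least 1, so the reverse map
    -- is again in its translation regime.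
    have h1 : 1 ≤ (1 + q⁻¹ - p⁻¹) * q := by
      have : (1 + q⁻¹ - p⁻¹) * q - 1 = q * (1 - p⁻¹) := by
        field_simp
        ring
      have := mul_nonneg hq.le (sub_nonneg.2 (inv_le_one_of_one_le₀ h))
      linarith
    rw [radialShift_factor_of_ge h1]
    generalize hc' : 1 + q⁻¹ - p⁻¹ = c at *
    calc (1 + (c * p)⁻¹ - (c * q)⁻¹) * c = c + c⁻¹ * c * (p⁻¹ - q⁻¹) := by
          rw [mul_inv, mul_inv]
          ring
      _ = 1 := by
          rw [inv_mul_cancel₀ hc.ne', ← hc']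
          ring

theorem radialShift_zero (P Q : Set (E n)) : radialShift P Q 0 = 0 := by
  simp [radialShift]

theorem continuous_radialShift {P Q : Set (E n)} (hP : Convex ℝ P) (hP0 : P ∈ 𝓝 0)
    (hQ : Convex ℝ Q) (hQ0 : Q ∈ 𝓝 0) (hQb : Bornology.IsVonNBounded ℝ Q) :
    Continuous (radialShift P Q) := by
  have h1 := continuous_gaugeRescale hP hP0 hQ hQ0 hQb
  have h2 : Continuous fun x => (max 1 (gauge P x))⁻¹ :=
    (continuous_const.max (continuous_gauge hP hP0)).inv₀ fun x =>
      (lt_max_of_lt_left one_pos).ne'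
  exact continuous_id.add (h2.smul (h1.sub continuous_id))

/-- `radialShift` as a homeomorphism. -/
noncomputable def radialShiftHomeomorph {P Q : Set (E n)} (hP : Convex ℝ P) (hP0 : P ∈ 𝓝 0)
    (hPb : Bornology.IsVonNBounded ℝ P) (hQ : Convex ℝ Q) (hQ0 : Q ∈ 𝓝 0)
    (hQb : Bornology.IsVonNBounded ℝ Q) : E n ≃ₜ E n where
  toFun := radialShift P Q
  invFun := radialShift Q P
  left_inv x := by
    rcases eq_or_ne x 0 with rfl | hx
    · rw [radialShift_zero, radialShift_zero]
    · exact radialShift_radialShift ((gauge_pos (absorbent_nhds_zero hP0) hPb).2 hx)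
        ((gauge_pos (absorbent_nhds_zero hQ0) hQb).2 hx)
  right_inv x := by
    rcases eq_or_ne x 0 with rfl | hx
    · rw [radialShift_zero, radialShift_zero]
    · exact radialShift_radialShift ((gauge_pos (absorbent_nhds_zero hQ0) hQb).2 hx)
        ((gauge_pos (absorbent_nhds_zero hP0) hPb).2 hx)
  continuous_toFun := continuous_radialShift hP hP0 hQ hQ0 hQb
  continuous_invFun := continuous_radialShift hQ hQ0 hP hP0 hPb

theorem gauge_radialShift_lt_one {P Q : Set (E n)} (hP0 : P ∈ 𝓝 0)
    (hPb : Bornology.IsVonNBounded ℝ P) (hQ0 : Q ∈ 𝓝 0) (hQb : Bornology.IsVonNBounded ℝ Q)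
    {x : E n} (hx : gauge P x < 1) : gauge Q (radialShift P Q x) < 1 := by
  rcases eq_or_ne x 0 with rfl | hx0
  · simp [radialShift_zero]
  · have hp := (gauge_pos (absorbent_nhds_zero hP0) hPb).2 hx0
    have hq := (gauge_pos (absorbent_nhds_zero hQ0) hQb).2 hx0
    rwa [gauge_radialShift hp hq, radialShift_factor_of_le hx.le, div_mul_cancel₀ _ hq.ne']

theorem radialShiftHomeomorph_image {P Q : Set (E n)} (hP : Convex ℝ P) (hP0 : P ∈ 𝓝 0)
    (hPb : Bornology.IsVonNBounded ℝ P) (hQ : Convex ℝ Q) (hQ0 : Q ∈ 𝓝 0)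
    (hQb : Bornology.IsVonNBounded ℝ Q) (hPo : IsOpen P) (hQo : IsOpen Q) :
    radialShiftHomeomorph hP hP0 hPb hQ hQ0 hQb '' P = Q := by
  have hPi : ∀ x, gauge P x < 1 ↔ x ∈ P := fun x => by
    rw [gauge_lt_one_iff_mem_interior hP hP0, hPo.interior_eq]
  have hQi : ∀ x, gauge Q x < 1 ↔ x ∈ Q := fun x => by
    rw [gauge_lt_one_iff_mem_interior hQ hQ0, hQo.interior_eq]
  apply Set.Subset.antisymm
  · rintro _ ⟨x, hx, rfl⟩
    exact (hQi _).1 (gauge_radialShift_lt_one hP0 hPb hQ0 hQb ((hPi x).2 hx))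
  · intro y hy
    exact ⟨radialShift Q P y, (hPi _).1 (gauge_radialShift_lt_one hQ0 hQb hP0 hPb ((hQi y).2 hy)),
      (radialShiftHomeomorph hP hP0 hPb hQ hQ0 hQb).right_inv y⟩

/-- The displacement of `radialShift` between nearby convex sets. -/
theorem dist_radialShift_le {P Q : Set (E n)} {r R η : ℝ} (hr : 0 < r)
    (hPr : Metric.ball 0 r ⊆ P) (hPR : P ⊆ Metric.closedBall 0 R) (hη : 0 < η) (hη' : η < 1)
    (hQb : Bornology.IsVonNBounded ℝ Q) (h : Near η P Q) (x : E n) :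
    dist x (radialShift P Q x) ≤ η * R := by
  have hQr := h.ball_subset hPr hη'
  have hη1 := sub_pos.2 hη'
  have hr' : 0 < (1 - η) * r := by positivity
  have hR : 0 ≤ R := by
    have := hPR (hPr (Metric.mem_ball_self hr))
    simpa using this
  rcases eq_or_ne x 0 with rfl | hx0
  · rw [radialShift_zero, dist_self]
    positivity
  have hPb : Bornology.IsVonNBounded ℝ P :=
    (NormedSpace.isVonNBounded_closedBall ℝ (E n) R).subset hPR
  have hp := (gauge_pos (absorbent_of_ball_subset hr hPr) hPb).2 hx0
  have hq := (gauge_pos (absorbent_of_ball_subset hr' hQr) hQb).2 hx0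
  have h1 := h.gauge_le hr' hQr hη x
  have h2 := h.le_gauge hr hPr hη' x
  have hnorm : ‖x‖ ≤ R * gauge P x := by
    have := le_gauge_of_subset_closedBall (absorbent_of_ball_subset hr hPr) hR hPR (x := x)
    -- Dividing by `R` needs `R > 0`; if `R = 0`, then `P ⊆ {0}` and `x` is a multiple of 0.
    rcases hR.eq_or_lt with h0 | h0
    · obtain ⟨b, -, -, y, hy, rfl⟩ := exists_lt_of_gauge_lt (absorbent_of_ball_subset hr hPr)
        (lt_add_one (gauge P x))
      have := hPR hy
      rw [← h0, mem_closedBall_zero_iff, norm_le_zero_iff] at this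
      simp [this, ← h0]
    · rwa [div_le_iff₀' h0] at this
  rw [radialShift_eq_smul, dist_comm, dist_eq_norm, add_smul, one_smul, add_sub_cancel_left,
    norm_smul, Real.norm_eq_abs, abs_mul, abs_inv, abs_of_pos (lt_max_of_lt_left one_pos)]
  have h3 : |gauge P x / gauge Q x - 1| ≤ η := by
    rw [abs_le]
    constructor
    · have := (le_div_iff₀ hq).2 h2
      linarith
    · have := (div_le_iff₀ hq).2 h1
      linarith
  have h4 : (max 1 (gauge P x))⁻¹ * ‖x‖ ≤ R := by
    rw [inv_mul_le_iff₀ (lt_max_of_lt_left one_pos), mul_comm]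
    exact hnorm.trans (mul_le_mul_of_nonneg_left (le_max_right _ _) hR)
  calc _ = |gauge P x / gauge Q x - 1| * ((max 1 (gauge P x))⁻¹ * ‖x‖) := by ring
    _ ≤ η * R := mul_le_mul h3 h4 (by positivity) hη.le

theorem homeoDist_le_of_near {P Q : Region n} (hP : Convex ℝ P.carrier) (hQ : Convex ℝ Q.carrier)
    {r R η : ℝ} (hr : 0 < r) (hPr : Metric.ball 0 r ⊆ P.carrier)
    (hPR : P.carrier ⊆ Metric.closedBall 0 R) (hη : 0 < η) (hη' : η < 1)
    (h : Near η P.carrier Q.carrier) : homeoDist P Q ≤ ENNReal.ofReal (η * R) := by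
  have hη1 := sub_pos.2 hη'
  have hP0 : P.carrier ∈ 𝓝 0 := Filter.mem_of_superset (Metric.ball_mem_nhds 0 hr) hPr
  have hQ0 : Q.carrier ∈ 𝓝 0 := Filter.mem_of_superset
    (Metric.ball_mem_nhds 0 (by positivity)) (h.ball_subset hPr hη')
  have hPb := NormedSpace.isVonNBounded_of_isBounded ℝ P.isBounded
  have hQb := NormedSpace.isVonNBounded_of_isBounded ℝ Q.isBounded
  refine iInf₂_le_of_le (radialShiftHomeomorph hP hP0 hPb hQ hQ0 hQb)
    (radialShiftHomeomorph_image hP hP0 hPb hQ hQ0 hQb P.isOpen Q.isOpen) (iSup_le fun x => ?_)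
  rw [edist_dist]
  exact ENNReal.ofReal_le_ofReal (dist_radialShift_le hr hPr hPR hη hη' hQb h x)

/-- The dual-Hausdorff distance is at most the homeomorphism distance. -/
theorem dualHausdorff_le_homeoDist (P Q : Region n) : dualHausdorff P Q ≤ homeoDist P Q := by
  refine le_iInf₂ fun γ hγ => ?_
  have key : ∀ A B : Set (E n), γ '' A = B →
      Metric.hausdorffEDist A B ≤ ⨆ x : E n, edist x (γ x) := by
    rintro A _ rfl
    refine Metric.hausdorffEDist_le_of_mem_edist ?_ ?_
    · exact fun x hx => ⟨γ x, ⟨x, hx, rfl⟩, le_iSup (fun x => edist x (γ x)) x⟩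
    · rintro _ ⟨x, hx, rfl⟩
      refine ⟨x, hx, ?_⟩
      rw [edist_comm]
      exact le_iSup (fun x => edist x (γ x)) x
  refine max_le (key _ _ hγ) ?_
  rw [Metric.hausdorffEDist_comm]
  exact key _ _ (by rw [Set.image_compl_eq γ.bijective, hγ])

theorem hausdorff_le_dualHausdorff (P Q : Region n) : hausdorff P Q ≤ dualHausdorff P Q :=
  le_max_left _ _

/-! ### Comparison of distances by means of nearby sets -/

/-- The translate of a region. -/
def Region.shift (a : E n) (P : Region n) : Region n where
  carrier := Homeomorph.addRight a '' P.carrier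
  nonempty := P.nonempty.image _
  isOpen := (Homeomorph.addRight a).isOpenMap _ P.isOpen
  isBounded := by
    have := (IsometryEquiv.addRight a).isometry.lipschitz.isBounded_image P.isBounded
    exact this
  regular := by
    rw [← Homeomorph.image_closure, ← Homeomorph.image_interior, P.regular]

theorem Region.ext_carrier {P Q : Region n} (h : P.carrier = Q.carrier) : P = Q := by
  cases P
  cases Q
  congr

theorem Region.shift_carrier (a : E n) (P : Region n) :
    (P.shift a).carrier = (fun x => x + a) '' P.carrier := rfl

theorem Region.shift_neg_shift (a : E n) (P : Region n) : (P.shift a).shift (-a) = P := by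
  apply Region.ext_carrier
  rw [Region.shift_carrier, Region.shift_carrier, Set.image_image]
  simp

theorem Region.convex_shift {P : Region n} (hP : Convex ℝ P.carrier) (a : E n) :
    Convex ℝ (P.shift a).carrier := by
  rw [Region.shift_carrier]
  simpa [add_comm] using hP.translate a

/-- A distance is invariant under translations if translations do not increase it. -/
theorem shift_eq_of_le {μ : Region n → Region n → ℝ≥0∞}
    (h : ∀ a P Q, μ (P.shift a) (Q.shift a) ≤ μ P Q) (a : E n) (P Q : Region n) :
    μ (P.shift a) (Q.shift a) = μ P Q := by
  refine le_antisymm (h a P Q) ?_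
  have := h (-a) (P.shift a) (Q.shift a)
  rwa [P.shift_neg_shift, Q.shift_neg_shift] at this

/-- A translation invariant distance between regions for which the convex regions close to a
convex region `P` that contains the origin are those that satisfy `Near η P` for small `η`. -/
structure IsNearCompatible (μ : Region n → Region n → ℝ≥0∞) : Prop where
  shift_eq : ∀ a P Q, μ (P.shift a) (Q.shift a) = μ P Q
  near_of_lt : ∀ P : Region n, Convex ℝ P.carrier → 0 ∈ P.carrier → ∀ η : ℝ, 0 < η → η ≤ 1 / 2 →
    ∃ δ, 0 < δ ∧ ∀ Q : Region n, Convex ℝ Q.carrier → μ P Q < δ → Near η P.carrier Q.carrier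
  lt_of_near : ∀ P : Region n, Convex ℝ P.carrier → 0 ∈ P.carrier → ∀ ε, 0 < ε →
    ∃ η : ℝ, 0 < η ∧ η ≤ 1 / 2 ∧
      ∀ Q : Region n, Convex ℝ Q.carrier → Near η P.carrier Q.carrier → μ P Q < ε

/-- Translate a point of `P` to the origin, then pass from `μ` to `ν` through nearness. -/
theorem IsNearCompatible.exists_ball_subset {μ ν : Region n → Region n → ℝ≥0∞}
    (hμ : IsNearCompatible μ) (hν : IsNearCompatible ν) (P : ConvexRegion n) {ε : ℝ≥0∞}
    (hε : 0 < ε) : ∃ δ, 0 < δ ∧ ball (fun P Q : ConvexRegion n => μ P.1 Q.1) P δ ⊆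
      ball (fun P Q : ConvexRegion n => ν P.1 Q.1) P ε := by
  obtain ⟨p, hp⟩ := P.1.nonempty
  have hc := Region.convex_shift P.2 (-p)
  have h0 : 0 ∈ (P.1.shift (-p)).carrier := ⟨p, hp, add_neg_cancel p⟩
  obtain ⟨η, hη, hη', h⟩ := hν.lt_of_near _ hc h0 ε hε
  obtain ⟨δ, hδ, h'⟩ := hμ.near_of_lt _ hc h0 η hη hη'
  refine ⟨δ, hδ, fun Q (hQ : μ P.1 Q.1 < δ) => show ν P.1 Q.1 < ε from ?_⟩
  have hQc := Region.convex_shift Q.2 (-p)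
  rw [← hν.shift_eq (-p)]
  exact h _ hQc (h' _ hQc (by rwa [hμ.shift_eq]))

theorem IsNearCompatible.convexTopology_eq {μ ν : Region n → Region n → ℝ≥0∞}
    (hμ : IsNearCompatible μ) (hν : IsNearCompatible ν) :
    convexTopology μ = convexTopology ν := by
  have key : ∀ {μ ν : Region n → Region n → ℝ≥0∞}, IsNearCompatible μ → IsNearCompatible ν →
      ∀ U, IsOpen[convexTopology ν] U → IsOpen[convexTopology μ] U := by
    intro μ ν hμ hν U hU P hP
    obtain ⟨ε, hε, h⟩ := hU P hP
    obtain ⟨δ, hδ, h'⟩ := hμ.exists_ball_subset hν P hε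
    exact ⟨δ, hδ, h'.trans h⟩
  exact TopologicalSpace.ext (funext fun U => propext ⟨key hν hμ U, key hμ hν U⟩)

/-- For a bare distance function balls need not be open in `distTopology`; the triangle inequality
makes them so for the Hausdorff distance, which therefore serves as the reference. -/
theorem isOpen_ball_hausdorff (P : ConvexRegion n) (r : ℝ≥0∞) :
    IsOpen[convexTopology (n := n) hausdorff]
      (ball (fun P Q : ConvexRegion n => hausdorff P.1 Q.1) P r) := by
  intro Q (hQ : hausdorff P.1 Q.1 < r)
  refine ⟨r - hausdorff P.1 Q.1, tsub_pos_of_lt hQ, fun S (hS : hausdorff Q.1 S.1 < _) => ?_⟩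
  exact Metric.hausdorffEDist_triangle.trans_lt
    ((ENNReal.add_lt_add_left hQ.ne_top hS).trans_eq (add_tsub_cancel_of_le hQ.le))

/-- Balls are neighbourhoods of their centres. -/
theorem IsNearCompatible.setOf_lt_mem_nhds {μ : Region n → Region n → ℝ≥0∞}
    (hμ : IsNearCompatible μ) (hH : IsNearCompatible (n := n) hausdorff) (P : ConvexRegion n)
    {r : ℝ≥0∞} (hr : 0 < r) :
    {Q : ConvexRegion n | μ P.1 Q.1 < r} ∈ @nhds _ (convexTopology μ) P := by
  rw [hμ.convexTopology_eq hH]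
  obtain ⟨δ, hδ, h⟩ := hH.exists_ball_subset hμ P hr
  refine (@mem_nhds_iff _ (convexTopology hausdorff) P _).2 ⟨_, h, isOpen_ball_hausdorff P δ, ?_⟩
  show Metric.hausdorffEDist P.1.carrier P.1.carrier < δ
  rwa [Metric.hausdorffEDist_self]

theorem exists_ball_subset_carrier (P : Region n) (h0 : 0 ∈ P.carrier) :
    ∃ r : ℝ, 0 < r ∧ Metric.ball 0 r ⊆ P.carrier :=
  Metric.isOpen_iff.1 P.isOpen 0 h0

theorem exists_carrier_subset_closedBall (P : Region n) :
    ∃ R : ℝ, 0 < R ∧ P.carrier ⊆ Metric.closedBall 0 R :=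
  P.isBounded.subset_closedBall_lt 0 0

theorem exists_pos_lt_of_tendsto {f : ℝ → ℝ≥0∞} (hf : Filter.Tendsto f (𝓝 0) (𝓝 0)) {ε : ℝ≥0∞}
    (hε : 0 < ε) : ∃ η : ℝ, 0 < η ∧ η ≤ 1 / 2 ∧ f η < ε := by
  have h1 : ∀ᶠ η in 𝓝[>] (0 : ℝ), f η < ε :=
    (hf.mono_left nhdsWithin_le_nhds).eventually (gt_mem_nhds hε)
  have h2 : ∀ᶠ η in 𝓝[>] (0 : ℝ), η ≤ 1 / 2 :=
    Filter.Eventually.filter_mono nhdsWithin_le_nhds (ge_mem_nhds (by norm_num))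
  obtain ⟨η, h, h', h''⟩ := (h1.and (h2.and self_mem_nhdsWithin)).exists
  exact ⟨η, h'', h', h⟩

/-! ### The Hausdorff distances and the homeomorphism distance -/

theorem hausdorff_shift (a : E n) (P Q : Region n) :
    hausdorff (P.shift a) (Q.shift a) = hausdorff P Q :=
  Metric.hausdorffEDist_image (IsometryEquiv.addRight a).isometry

theorem dualHausdorff_shift (a : E n) (P Q : Region n) :
    dualHausdorff (P.shift a) (Q.shift a) = dualHausdorff P Q := by
  have hc : ∀ P : Region n, (P.shift a).carrierᶜ = Homeomorph.addRight a '' P.carrierᶜ :=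
    fun P => (Set.image_compl_eq (Homeomorph.addRight a).bijective).symm
  rw [dualHausdorff, dualHausdorff, hausdorff_shift, hc, hc]
  congr 1
  exact Metric.hausdorffEDist_image (IsometryEquiv.addRight a).isometry

theorem homeoDist_shift (a : E n) (P Q : Region n) :
    homeoDist (P.shift a) (Q.shift a) = homeoDist P Q := by
  refine shift_eq_of_le (μ := homeoDist) (fun a P Q => ?_) a P Q
  refine le_iInf₂ fun γ hγ => ?_
  -- Conjugating by the translation preserves the displacements.
  refine iInf₂_le_of_le (((Homeomorph.addRight a).symm.trans γ).trans (Homeomorph.addRight a))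
    ?_ (iSup_le fun x => ?_)
  · show _ '' (Homeomorph.addRight a '' P.carrier) = Homeomorph.addRight a '' Q.carrier
    rw [← hγ, Set.image_image, Set.image_image]
    exact Set.image_congr fun x _ =>
      congrArg (fun y => γ y + a) ((Homeomorph.addRight a).symm_apply_apply x)
  · refine le_trans (le_of_eq ?_) (le_iSup (fun x => edist x (γ x)) (x + -a))
    show edist x (γ (x + -a) + a) = edist (x + -a) (γ (x + -a))
    rw [← edist_add_right (x + -a) _ a, neg_add_cancel_right]

/-- The centre of the far ball already witnesses a Hausdorff distance of at least its radius. -/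
theorem exists_hausdorff_lt_imp_near (P : Region n) (hP : Convex ℝ P.carrier)
    (h0 : 0 ∈ P.carrier) (η : ℝ) (hη : 0 < η) (hη' : η ≤ 1 / 2) :
    ∃ δ, 0 < δ ∧ ∀ Q : Region n, Convex ℝ Q.carrier → hausdorff P Q < δ →
      Near η P.carrier Q.carrier := by
  obtain ⟨r, hr, hPr⟩ := exists_ball_subset_carrier P h0
  have hρ : 0 < η * r / 8 := by positivity
  refine ⟨ENNReal.ofReal (η * r / 8), ENNReal.ofReal_pos.2 hρ, fun Q hQ hlt => ?_⟩
  rcases near_or_exists_ball_far hP P.isOpen hr hPr hQ Q.isOpen hη hη' with h | ⟨y, h⟩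
  · exact h
  exfalso
  have key : ∀ A B : Set (E n), Metric.hausdorffEDist A B < ENNReal.ofReal (η * r / 8) →
      Metric.ball y (η * r / 8) ⊆ A → Far (η * r / 8) (Metric.ball y (η * r / 8)) B → False := by
    intro A B hAB hA hf
    have hy := Metric.mem_ball_self (x := y) hρ
    obtain ⟨z, hz, hyz⟩ := Metric.exists_edist_lt_of_hausdorffEDist_lt (hA hy) hAB
    rw [edist_dist, ENNReal.ofReal_lt_ofReal_iff hρ] at hyz
    exact hyz.not_ge (hf y hy z hz)
  rcases h with h | h
  · exact key _ _ hlt h.1 h.2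
  · exact key _ _ (by rwa [Metric.hausdorffEDist_comm]) h.1 h.2

theorem exists_near_imp_homeoDist_lt (P : Region n) (hP : Convex ℝ P.carrier)
    (h0 : 0 ∈ P.carrier) (ε : ℝ≥0∞) (hε : 0 < ε) :
    ∃ η : ℝ, 0 < η ∧ η ≤ 1 / 2 ∧ ∀ Q : Region n, Convex ℝ Q.carrier →
      Near η P.carrier Q.carrier → homeoDist P Q < ε := by
  obtain ⟨r, hr, hPr⟩ := exists_ball_subset_carrier P h0
  obtain ⟨R, hR, hPR⟩ := exists_carrier_subset_closedBall P
  have ht : Filter.Tendsto (fun η : ℝ => ENNReal.ofReal (η * R)) (𝓝 0) (𝓝 0) := by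
    have : Continuous fun η : ℝ => ENNReal.ofReal (η * R) :=
      ENNReal.continuous_ofReal.comp (by fun_prop)
    simpa using this.tendsto 0
  obtain ⟨η, hη, hη', h⟩ := exists_pos_lt_of_tendsto ht hε
  exact ⟨η, hη, hη', fun Q hQ hn =>
    (homeoDist_le_of_near hP hQ hr hPr hPR hη (by linarith) hn).trans_lt h⟩

theorem isNearCompatible_homeoDist : IsNearCompatible (n := n) homeoDist where
  shift_eq := homeoDist_shift
  near_of_lt P hP h0 η hη hη' := by
    obtain ⟨δ, hδ, h⟩ := exists_hausdorff_lt_imp_near P hP h0 η hη hη'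
    exact ⟨δ, hδ, fun Q hQ hlt => h Q hQ (((hausdorff_le_dualHausdorff P Q).trans
      (dualHausdorff_le_homeoDist P Q)).trans_lt hlt)⟩
  lt_of_near := exists_near_imp_homeoDist_lt

theorem isNearCompatible_dualHausdorff : IsNearCompatible (n := n) dualHausdorff where
  shift_eq := dualHausdorff_shift
  near_of_lt P hP h0 η hη hη' := by
    obtain ⟨δ, hδ, h⟩ := exists_hausdorff_lt_imp_near P hP h0 η hη hη'
    exact ⟨δ, hδ, fun Q hQ hlt => h Q hQ ((hausdorff_le_dualHausdorff P Q).trans_lt hlt)⟩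
  lt_of_near P hP h0 ε hε := by
    obtain ⟨η, hη, hη', h⟩ := exists_near_imp_homeoDist_lt P hP h0 ε hε
    exact ⟨η, hη, hη', fun Q hQ hn => (dualHausdorff_le_homeoDist P Q).trans_lt (h Q hQ hn)⟩

theorem isNearCompatible_hausdorff : IsNearCompatible (n := n) hausdorff where
  shift_eq := hausdorff_shift
  near_of_lt := exists_hausdorff_lt_imp_near
  lt_of_near P hP h0 ε hε := by
    obtain ⟨η, hη, hη', h⟩ := exists_near_imp_homeoDist_lt P hP h0 ε hε
    exact ⟨η, hη, hη', fun Q hQ hn => ((hausdorff_le_dualHausdorff P Q).trans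
      (dualHausdorff_le_homeoDist P Q)).trans_lt (h Q hQ hn)⟩

/-! ### The symmetric-difference distance -/

theorem volume_shift (a : E n) (A : Set (E n)) :
    volume (Homeomorph.addRight a '' A) = volume A := by
  simp

theorem symmDiffDist_shift (a : E n) (P Q : Region n) :
    symmDiffDist (P.shift a) (Q.shift a) = symmDiffDist P Q := by
  rw [symmDiffDist, symmDiffDist, ← volume_shift a ((P.carrier \ Q.carrier) ∪ _),
    Set.image_union, Set.image_sdiff (Homeomorph.addRight a).injective,
    Set.image_sdiff (Homeomorph.addRight a).injective]
  rfl

theorem volume_image_smul {c : ℝ} (hc : 0 ≤ c) (A : Set (E n)) :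
    volume ((fun x => c • x) '' A) = ENNReal.ofReal (c ^ n) * volume A := by
  have := Measure.addHaar_smul (volume : Measure (E n)) c A
  rwa [finrank_euclideanSpace_fin, abs_of_nonneg (pow_nonneg hc n)] at this

/-- Dilates of a convex set that contains the origin are ordered by inclusion. -/
theorem image_smul_subset_image_smul {P : Set (E n)} (hP : Convex ℝ P) (h0 : 0 ∈ P) {s t : ℝ}
    (hs : 0 ≤ s) (hst : s ≤ t) : (fun x => s • x) '' P ⊆ (fun x => t • x) '' P := by
  rintro _ ⟨p, hp, rfl⟩
  rcases hs.eq_or_lt with rfl | hs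
  · exact ⟨0, h0, by simp⟩
  have ht : 0 < t := hs.trans_le hst
  refine ⟨(s / t) • p, hP.smul_mem_of_zero_mem h0 hp ⟨by positivity, (div_le_one ht).2 hst⟩, ?_⟩
  simp only
  rw [smul_smul, mul_div_cancel₀ _ ht.ne']

/-- The part of the dilate of `P` by `1 + η` outside the dilate by `1 - η`. -/
def shell (η : ℝ) (P : Set (E n)) : Set (E n) :=
  (fun x => (1 + η) • x) '' P \ (fun x => (1 - η) • x) '' P

theorem isOpen_image_smul {P : Set (E n)} (hP : IsOpen P) {c : ℝ} (hc : c ≠ 0) :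
    IsOpen ((fun x => c • x) '' P) :=
  (Homeomorph.smulOfNeZero c hc).isOpenMap P hP

theorem volume_shell (P : Region n) (hP : Convex ℝ P.carrier) (h0 : 0 ∈ P.carrier) {η : ℝ}
    (hη : 0 ≤ η) (hη' : η < 1) : volume (shell η P.carrier) =
      ENNReal.ofReal ((1 + η) ^ n - (1 - η) ^ n) * volume P.carrier := by
  have h1 : 0 ≤ 1 - η := by linarith
  have hlt := P.isBounded.measure_lt_top (μ := (volume : Measure (E n)))
  rw [shell, measure_sdiff (image_smul_subset_image_smul hP h0 h1 (by linarith))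
    (isOpen_image_smul P.isOpen (by linarith)).measurableSet.nullMeasurableSet,
    volume_image_smul (by linarith), volume_image_smul h1, ← ENNReal.sub_mul,
    ENNReal.ofReal_sub _ (by positivity)]
  · exact fun _ _ => hlt.ne
  · rw [volume_image_smul h1]
    exact ENNReal.mul_ne_top ENNReal.ofReal_ne_top hlt.ne

/-- The far ball lies entirely in the symmetric difference, so its volume serves as the threshold.
-/
theorem exists_symmDiffDist_lt_imp_near (P : Region n) (hP : Convex ℝ P.carrier)
    (h0 : 0 ∈ P.carrier) (η : ℝ) (hη : 0 < η) (hη' : η ≤ 1 / 2) :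
    ∃ δ, 0 < δ ∧ ∀ Q : Region n, Convex ℝ Q.carrier → symmDiffDist P Q < δ →
      Near η P.carrier Q.carrier := by
  obtain ⟨r, hr, hPr⟩ := exists_ball_subset_carrier P h0
  have hρ : 0 < η * r / 8 := by positivity
  refine ⟨volume (Metric.ball (0 : E n) (η * r / 8)), Metric.measure_ball_pos _ _ hρ,
    fun Q hQ hlt => ?_⟩
  rcases near_or_exists_ball_far hP P.isOpen hr hPr hQ Q.isOpen hη hη' with h | ⟨y, h⟩
  · exact h
  exfalso
  refine hlt.not_ge ?_
  rw [← Measure.addHaar_ball_center volume y]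
  have key : ∀ A : Set (E n), Far (η * r / 8) (Metric.ball y (η * r / 8)) A →
      ∀ z ∈ Metric.ball y (η * r / 8), z ∉ A := fun A hf z hz hzA =>
    (hf z hz z hzA).not_gt (by rwa [dist_self])
  rcases h with h | h
  · exact measure_mono fun z hz => Or.inl ⟨h.1 hz, key _ h.2 z hz⟩
  · exact measure_mono fun z hz => Or.inr ⟨h.1 hz, key _ h.2 z hz⟩

theorem tendsto_pow_sub_pow : Filter.Tendsto (fun η : ℝ => (1 + η) ^ n - (1 - η) ^ n)
    (𝓝 0) (𝓝 0) := by
  have : Continuous fun η : ℝ => (1 + η) ^ n - (1 - η) ^ n := by fun_prop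
  simpa using this.tendsto 0

theorem isNearCompatible_symmDiffDist : IsNearCompatible (n := n) symmDiffDist where
  shift_eq := symmDiffDist_shift
  near_of_lt := exists_symmDiffDist_lt_imp_near
  lt_of_near P hP h0 ε hε := by
    have hlt := P.isBounded.measure_lt_top (μ := (volume : Measure (E n)))
    have ht : Filter.Tendsto (fun η : ℝ =>
        ENNReal.ofReal ((1 + η) ^ n - (1 - η) ^ n) * volume P.carrier) (𝓝 0) (𝓝 0) := by
      have := ENNReal.Tendsto.mul_const (b := volume P.carrier)
        (ENNReal.tendsto_ofReal (tendsto_pow_sub_pow (n := n))) (Or.inr hlt.ne)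
      simpa using this
    obtain ⟨η, hη, hη', h⟩ := exists_pos_lt_of_tendsto ht hε
    refine ⟨η, hη, hη', fun Q hQ hn => lt_of_le_of_lt ?_ h⟩
    rw [← volume_shell P hP h0 hη.le (by linarith)]
    have h1 := image_smul_subset_image_smul hP h0 zero_le_one (show 1 ≤ 1 + η by linarith)
    have h2 := image_smul_subset_image_smul hP h0 (show 0 ≤ 1 - η by linarith)
      (show 1 - η ≤ 1 by linarith)
    simp only [one_smul, Set.image_id'] at h1 h2
    refine measure_mono (Set.union_subset ?_ ?_)
    · exact Set.sdiff_subset_sdiff h1 hn.1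
    · exact Set.sdiff_subset_sdiff hn.2 h2

/-! ### The Wasserstein distances -/

theorem IsMulholland.surjective {ψ : ℝ≥0 → ℝ≥0} (hψ : IsMulholland ψ) :
    Function.Surjective ψ := fun y =>
  mem_range_of_exists_le_of_exists_ge hψ.continuous ⟨0, by simp [hψ.map_zero]⟩
    (hψ.tendsto.eventually_ge_atTop y).exists

theorem IsMulholland.pos {ψ : ℝ≥0 → ℝ≥0} (hψ : IsMulholland ψ) {t : ℝ≥0} (ht : 0 < t) :
    0 < ψ t := by
  rw [← hψ.map_zero]
  exact hψ.strictMono ht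

/-- Turns bounds on the Wasserstein distance into bounds on the transport cost; the value ∞ is
consistent because `ψ δ` is finite. -/
theorem IsMulholland.psiInv_lt_iff {ψ : ℝ≥0 → ℝ≥0} (hψ : IsMulholland ψ) {s : ℝ≥0∞} {δ : ℝ≥0} :
    psiInv ψ s < δ ↔ s < ψ δ := by
  rcases eq_or_ne s ∞ with rfl | hs
  · simp [psiInv]
  lift s to ℝ≥0 using hs
  obtain ⟨u, rfl⟩ := hψ.surjective s
  rw [psiInv, if_neg ENNReal.coe_ne_top, ENNReal.toNNReal_coe,
    Function.leftInverse_invFun hψ.strictMono.injective, ENNReal.coe_lt_coe, ENNReal.coe_lt_coe,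
    hψ.strictMono.lt_iff_lt]

theorem IsMulholland.exists_pos_lt {ψ : ℝ≥0 → ℝ≥0} (hψ : IsMulholland ψ) {ε : ℝ≥0∞}
    (hε : 0 < ε) : ∃ δ : ℝ≥0, 0 < δ ∧ (ψ δ : ℝ≥0∞) < ε := by
  obtain ⟨e, he, he'⟩ := ENNReal.lt_iff_exists_nnreal_btwn.1 hε
  obtain ⟨δ, rfl⟩ := hψ.surjective e
  refine ⟨δ, pos_iff_ne_zero.2 ?_, he'⟩
  rintro rfl
  simp [hψ.map_zero] at he

theorem volume_carrier_ne_top (P : Region n) : volume P.carrier ≠ ∞ :=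
  P.isBounded.measure_lt_top.ne

theorem volume_carrier_ne_zero (P : Region n) : volume P.carrier ≠ 0 :=
  (P.isOpen.measure_pos _ P.nonempty).ne'

instance (P : Region n) : IsProbabilityMeasure (uniformDist P) :=
  ProbabilityTheory.cond_isProbabilityMeasure_of_finite (volume_carrier_ne_zero P)
    (volume_carrier_ne_top P)

theorem uniformDist_apply (P : Region n) (A : Set (E n)) :
    uniformDist P A = (volume P.carrier)⁻¹ * volume (P.carrier ∩ A) :=
  ProbabilityTheory.cond_apply P.isOpen.measurableSet _ _

theorem uniformDist_apply_of_subset (P : Region n) {A : Set (E n)} (h : A ⊆ P.carrier) :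
    uniformDist P A = (volume P.carrier)⁻¹ * volume A := by
  rw [uniformDist_apply, Set.inter_eq_self_of_subset_right h]

theorem ae_mem_uniformDist (P : Region n) : ∀ᵐ x ∂uniformDist P, x ∈ P.carrier := by
  rw [ae_iff]
  change uniformDist P P.carrierᶜ = 0
  rw [uniformDist_apply, Set.inter_compl_self, measure_empty, mul_zero]

theorem uniformDist_shift (a : E n) (P : Region n) :
    uniformDist (P.shift a) = (uniformDist P).map (Homeomorph.addRight a) := by
  have hme := (Homeomorph.addRight a).measurableEmbedding
  have hmap : (volume : Measure (E n)).map (Homeomorph.addRight a) = volume :=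
    map_add_right_eq_self volume a
  have h1 : volume (P.shift a).carrier = volume P.carrier := volume_shift a P.carrier
  have h2 := hme.restrict_map volume (P.shift a).carrier
  rw [hmap, show Homeomorph.addRight a ⁻¹' (P.shift a).carrier = P.carrier from
    Set.preimage_image_eq _ (Homeomorph.addRight a).injective] at h2
  rw [uniformDist, uniformDist, ProbabilityTheory.cond, ProbabilityTheory.cond,
    Measure.map_smul, h1, h2]

theorem wasserstein_shift (ψ : ℝ≥0 → ℝ≥0) (a : E n) (P Q : Region n) :
    wasserstein ψ (P.shift a) (Q.shift a) = wasserstein ψ P Q := by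
  refine shift_eq_of_le (μ := wasserstein ψ) (fun a P Q => ?_) a P Q
  refine le_iInf₂ fun γ hγ => ?_
  have hme := (Homeomorph.addRight a).measurableEmbedding
  have hcomp : ((Homeomorph.addRight a ∘ γ ∘ (Homeomorph.addRight a).symm) ∘
      Homeomorph.addRight a) = Homeomorph.addRight a ∘ γ := by
    funext x
    exact congrArg (fun y => γ y + a) ((Homeomorph.addRight a).symm_apply_apply x)
  have hm : Measurable (Homeomorph.addRight a ∘ γ ∘ (Homeomorph.addRight a).symm) :=
    hme.measurable.comp (hγ.1.comp (Homeomorph.addRight a).symm.measurable)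
  refine iInf₂_le_of_le (Homeomorph.addRight a ∘ γ ∘ (Homeomorph.addRight a).symm) ⟨hm, ?_⟩
    (le_of_eq (congrArg _ ?_))
  · rw [uniformDist_shift, uniformDist_shift, Measure.map_map hm hme.measurable, hcomp,
      ← Measure.map_map hme.measurable hγ.1, hγ.2]
  · rw [uniformDist_shift, transportCost, hme.lintegral_map]
    refine lintegral_congr fun x => ?_
    have : (Homeomorph.addRight a ∘ γ ∘ (Homeomorph.addRight a).symm) (Homeomorph.addRight a x) =
        γ x + a := congrFun hcomp x
    rw [this, Homeomorph.coe_addRight, nndist_add_right]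

/-- Markov's inequality for the transport cost. -/
theorem mul_measure_le_transportCost {ψ : ℝ≥0 → ℝ≥0} (hψ : IsMulholland ψ) (θ : Measure (E n))
    {γ : E n → E n} (hγ : Measurable γ) {A : Set (E n)} {ρ : ℝ}
    (h : ∀ x ∈ A, ρ ≤ dist x (γ x)) : ψ ρ.toNNReal * θ A ≤ transportCost ψ θ γ := by
  have hm : Measurable fun x => (ψ (nndist x (γ x)) : ℝ≥0∞) :=
    (hψ.continuous.measurable.comp (measurable_id.nndist hγ)).coe_nnreal_ennreal
  refine le_trans ?_ (mul_meas_ge_le_lintegral hm (ψ ρ.toNNReal))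
  gcongr
  intro x hx
  refine ENNReal.coe_le_coe.2 (hψ.strictMono.monotone ?_)
  exact Real.toNNReal_le_iff_le_coe.2 (h x hx)

theorem exists_transport_of_wasserstein_lt {ψ : ℝ≥0 → ℝ≥0} (hψ : IsMulholland ψ) {P Q : Region n}
    {δ : ℝ≥0} (h : wasserstein ψ P Q < δ) : ∃ γ : E n → E n, Measurable γ ∧
      (uniformDist P).map γ = uniformDist Q ∧ transportCost ψ (uniformDist P) γ < ψ δ := by
  rw [wasserstein, wassersteinMeasure] at h
  simp only [iInf_lt_iff] at h
  obtain ⟨γ, ⟨hγ, hm⟩, hlt⟩ := h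
  exact ⟨γ, hγ, hm, hψ.psiInv_lt_iff.1 hlt⟩

/-- If the distribution of `Q` is obtained from that of `P` at a low cost, then the volume of `Q`
is bounded. -/
theorem volume_le_of_transportCost_lt {ψ : ℝ≥0 → ℝ≥0} (hψ : IsMulholland ψ) {P Q : Region n}
    (hP : Convex ℝ P.carrier) {r : ℝ} (hr : 0 < r) (hPr : Metric.ball 0 r ⊆ P.carrier)
    {γ : E n → E n} (hγ : Measurable γ) (hm : (uniformDist P).map γ = uniformDist Q)
    (hcost : transportCost ψ (uniformDist P) γ < ψ r.toNNReal * 2⁻¹) :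
    volume Q.carrier ≤ 2 * volume ((fun x => (2 : ℝ) • x) '' P.carrier) := by
  set D := (fun x => (2 : ℝ) • x) '' P.carrier with hD
  have hDm : MeasurableSet D := (isOpen_image_smul P.isOpen two_ne_zero).measurableSet
  -- A point of `P` sent outside `2P` raises its gauge from below 1 to at least 2, so it travels at
  -- least `r`. The cost bound then lets less than half of the mass leave `2P`.
  have h1 := mul_measure_le_transportCost hψ (uniformDist P) hγ (A := P.carrier ∩ γ ⁻¹' Dᶜ)
    (ρ := r) (fun x hx => by
      have h1 := gauge_sub_gauge_le hP hr hPr (γ x) x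
      have h2 := (gauge_lt_one_iff hP P.isOpen hr hPr).2 hx.1
      have h3 : 2 ≤ gauge P.carrier (γ x) := le_gauge_of_notMem
        (hP.starConvex (hPr (Metric.mem_ball_self hr))) (absorbent_of_ball_subset hr hPr _)
          (fun h => hx.2 h)
      rw [dist_comm] at h1
      nlinarith)
  have h2 : uniformDist P (P.carrier ∩ γ ⁻¹' Dᶜ) = uniformDist Q Dᶜ := by
    rw [← hm, Measure.map_apply hγ hDm.compl, uniformDist_apply, uniformDist_apply,
      ← Set.inter_assoc, Set.inter_self]
  rw [h2] at h1
  have hψr : (ψ r.toNNReal : ℝ≥0∞) ≠ 0 :=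
    ENNReal.coe_ne_zero.2 (hψ.pos (Real.toNNReal_pos.2 hr)).ne'
  have h3 : uniformDist Q Dᶜ < 2⁻¹ := lt_of_mul_lt_mul_left' (h1.trans_lt hcost)
  have h4 : (2 : ℝ≥0∞)⁻¹ ≤ uniformDist Q D := by
    by_contra! hlt
    have := ENNReal.add_lt_add hlt h3
    rw [measure_add_measure_compl hDm, measure_univ, ENNReal.inv_two_add_inv_two] at this
    exact this.false
  have h5 : (2 : ℝ≥0∞)⁻¹ ≤ (volume Q.carrier)⁻¹ * volume D := by
    refine h4.trans ?_
    rw [uniformDist_apply]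
    gcongr
    exact Set.inter_subset_right
  calc volume Q.carrier = 2 * volume Q.carrier * 2⁻¹ := by
        rw [mul_right_comm, ENNReal.mul_inv_cancel two_ne_zero ENNReal.ofNat_ne_top, one_mul]
    _ ≤ 2 * volume Q.carrier * ((volume Q.carrier)⁻¹ * volume D) := by gcongr
    _ = 2 * volume D := by
        rw [mul_assoc, ← mul_assoc (volume Q.carrier),
          ENNReal.mul_inv_cancel (volume_carrier_ne_zero Q) (volume_carrier_ne_top Q), one_mul]

theorem exists_wasserstein_lt_imp_near {ψ : ℝ≥0 → ℝ≥0} (hψ : IsMulholland ψ) (P : Region n)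
    (hP : Convex ℝ P.carrier) (h0 : 0 ∈ P.carrier) (η : ℝ) (hη : 0 < η) (hη' : η ≤ 1 / 2) :
    ∃ δ, 0 < δ ∧ ∀ Q : Region n, Convex ℝ Q.carrier → wasserstein ψ P Q < δ →
      Near η P.carrier Q.carrier := by
  obtain ⟨r, hr, hPr⟩ := exists_ball_subset_carrier P h0
  have hρ : 0 < η * r / 8 := by positivity
  set ρ := η * r / 8 with hρdef
  set K := 2 * volume ((fun x => (2 : ℝ) • x) '' P.carrier) with hK
  set c := volume (Metric.ball (0 : E n) ρ) with hc
  have hKtop : K ≠ ∞ := by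
    rw [hK, volume_image_smul zero_le_two]
    exact ENNReal.mul_ne_top ENNReal.ofNat_ne_top
      (ENNReal.mul_ne_top ENNReal.ofReal_ne_top (volume_carrier_ne_top P))
  have hPK : volume P.carrier ≤ K := by
    have h1 := image_smul_subset_image_smul hP h0 zero_le_one one_le_two
    simp only [one_smul, Set.image_id'] at h1
    refine (measure_mono h1).trans ?_
    rw [hK, two_mul]
    exact le_self_add
  have hψ0 : ∀ t : ℝ, 0 < t → (ψ t.toNNReal : ℝ≥0∞) ≠ 0 := fun t ht =>
    ENNReal.coe_ne_zero.2 (hψ.pos (Real.toNNReal_pos.2 ht)).ne'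
  have hc0 : c ≠ 0 := (Metric.measure_ball_pos _ _ hρ).ne'
  -- The first bound gives `volume Q ≤ K`. The second is the cost of moving the mass of a ball of
  -- radius `ρ`, at least `c / K` in either region, over the distance `ρ`.
  obtain ⟨δ, hδ, hδψ⟩ := hψ.exists_pos_lt
    (ε := min (ψ r.toNNReal * 2⁻¹) (ψ ρ.toNNReal * (K⁻¹ * c)))
    (lt_min (ENNReal.mul_pos (hψ0 r hr) (by simp))
      (ENNReal.mul_pos (hψ0 ρ hρ) (mul_ne_zero (ENNReal.inv_ne_zero.2 hKtop) hc0)))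
  refine ⟨δ, ENNReal.coe_pos.2 hδ, fun Q hQ hlt => ?_⟩
  obtain ⟨γ, hγ, hm, hcost⟩ := exists_transport_of_wasserstein_lt hψ hlt
  have hcost := hcost.trans hδψ
  have hQK : volume Q.carrier ≤ K :=
    volume_le_of_transportCost_lt hψ hP hr hPr hγ hm (hcost.trans_le (min_le_left _ _))
  have hcost := hcost.trans_le (min_le_right _ _)
  rcases near_or_exists_ball_far hP P.isOpen hr hPr hQ Q.isOpen hη hη' with h | ⟨y, h⟩
  · exact h
  exfalso
  rw [← hρdef] at h
  have key : ∀ (S : Region n) (A : Set (E n)), volume S.carrier ≤ K →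
      Metric.ball y ρ ⊆ S.carrier → uniformDist S (Metric.ball y ρ) ≤ uniformDist P A →
      (∀ x ∈ A, ρ ≤ dist x (γ x)) → False := by
    intro S A hS hb hle hA
    refine hcost.not_ge (le_trans ?_ (mul_measure_le_transportCost hψ (uniformDist P) hγ hA))
    gcongr
    refine le_trans ?_ hle
    rw [uniformDist_apply_of_subset S hb, Measure.addHaar_ball_center]
    gcongr
  -- A far ball in `P` must send its mass into `Q`; a far ball in `Q` must receive its mass from
  -- `P`. Either way that mass travels at least `ρ`.
  rcases h with ⟨hb, hf⟩ | ⟨hb, hf⟩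
  · refine key P (Metric.ball y ρ ∩ γ ⁻¹' Q.carrier) hPK hb (le_of_eq ?_)
      (fun x hx => hf x hx.1 _ hx.2)
    have hae : ∀ᵐ x ∂uniformDist P, γ x ∈ Q.carrier := by
      refine ae_of_ae_map hγ.aemeasurable ?_
      rw [hm]
      exact ae_mem_uniformDist Q
    refine measure_congr ?_
    filter_upwards [hae] with x hx
    exact propext ⟨fun h => ⟨h, hx⟩, fun h => h.1⟩
  · refine key Q (P.carrier ∩ γ ⁻¹' Metric.ball y ρ) hQK hb (le_of_eq ?_)
      (fun x hx => by
        rw [dist_comm]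
        exact hf _ hx.2 x hx.1)
    rw [← hm, Measure.map_apply hγ Metric.isOpen_ball.measurableSet, uniformDist_apply,
      uniformDist_apply, ← Set.inter_assoc, Set.inter_self]

/-! ### Transport between nearby convex sets -/

/-- The volume of a set near `P` is the volume of a dilate of `P`. -/
theorem exists_volume_image_smul_eq {P Q : Region n} {η : ℝ} (hη : 0 < η) (hη' : η < 1)
    (h : Near η P.carrier Q.carrier) : ∃ l : ℝ, 1 - η ≤ l ∧ l ≤ 1 + η ∧
      volume ((fun x => l • x) '' P.carrier) = volume Q.carrier := by
  have h1 := measure_mono (μ := volume) h.1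
  have h2 := measure_mono (μ := volume) h.2
  have hcont : Continuous fun l : ℝ => ENNReal.ofReal (l ^ n) * volume P.carrier :=
    ENNReal.continuous_mul_const (volume_carrier_ne_top P) |>.comp
      (ENNReal.continuous_ofReal.comp (by fun_prop))
  rw [volume_image_smul (by linarith)] at h1 h2
  -- The volume of the dilate is continuous in `l`, and nearness puts `volume Q` between its end
  -- values.
  obtain ⟨l, hl, hl'⟩ := intermediate_value_Icc (show 1 - η ≤ 1 + η by linarith)
    hcont.continuousOn ⟨h1, h2⟩
  exact ⟨l, hl.1, hl.2, by rw [volume_image_smul (by linarith [hl.1])]; exact hl'⟩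

/-- The dilation by `l` maps the uniform distribution over `P` to that over the dilate. -/
theorem map_smul_uniformDist (P : Region n) {l : ℝ} (hl : 0 < l) :
    (uniformDist P).map (fun x => l • x) =
      ProbabilityTheory.cond volume ((fun x => l • x) '' P.carrier) := by
  have hPo := isOpen_image_smul P.isOpen hl.ne'
  have hm : Measurable fun x : E n => l • x := measurable_const_smul l
  ext A hA
  rw [Measure.map_apply hm hA, uniformDist_apply, ProbabilityTheory.cond_apply hPo.measurableSet,
    ← Set.image_inter_preimage, volume_image_smul hl.le, volume_image_smul hl.le]
  have h1 : ENNReal.ofReal (l ^ n) ≠ 0 := (ENNReal.ofReal_pos.2 (by positivity)).ne'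
  rw [ENNReal.mul_inv (Or.inl h1) (Or.inl ENNReal.ofReal_ne_top), mul_mul_mul_comm,
    ENNReal.inv_mul_cancel h1 ENNReal.ofReal_ne_top, one_mul]

/-- A transport map between sets of the same finite measure that fixes their intersection. -/
theorem exists_map_restrict_eq_of_measure_eq {X : Type*} [MeasurableSpace X]
    [StandardBorelSpace X] (μ : Measure X) [NullSingletonClass μ] {A B : Set X}
    (hA : MeasurableSet A) (hB : MeasurableSet B) (h : μ A = μ B) (hfin : μ A ≠ ∞) :
    ∃ T : X → X, Measurable T ∧ (μ.restrict A).map T = μ.restrict B ∧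
      ∀ x, x ∉ A \ B → T x = x := by
  classical
  -- Cancel the measure of `A ∩ B`, which is finite.
  have hd : μ (A \ B) = μ (B \ A) := by
    have h1 := measure_inter_add_sdiff (μ := μ) A hB
    have h2 := measure_inter_add_sdiff (μ := μ) B hA
    rw [Set.inter_comm, ← h, ← h1, Set.inter_comm] at h2
    exact ((ENNReal.add_right_inj (measure_ne_top_of_subset Set.inter_subset_right hfin)).1 h2).symm
  obtain ⟨T, hT, hTm⟩ := exists_measurable_map_restrict_eq μ hd
    (measure_ne_top_of_subset Set.sdiff_subset hfin)
  have hm : Measurable ((A \ B).piecewise T id) := hT.piecewise (hA.diff hB) measurable_id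
  refine ⟨(A \ B).piecewise T id, hm, ?_, fun x hx => Set.piecewise_eq_of_notMem _ _ _ hx⟩
  have h1 : (μ.restrict (A \ B)).map ((A \ B).piecewise T id) = μ.restrict (B \ A) := by
    rw [← hTm]
    refine Measure.map_congr ?_
    filter_upwards [ae_restrict_mem (hA.diff hB)] with x hx
    exact Set.piecewise_eq_of_mem _ _ _ hx
  have h2 : (μ.restrict (A ∩ B)).map ((A \ B).piecewise T id) = μ.restrict (A ∩ B) := by
    conv_rhs => rw [← Measure.map_id (μ := μ.restrict (A ∩ B))]
    refine Measure.map_congr ?_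
    filter_upwards [ae_restrict_mem (hA.inter hB)] with x hx
    exact Set.piecewise_eq_of_notMem _ _ _ fun h => h.2 hx.2
  rw [← Measure.restrict_inter_add_sdiff A hB, Measure.map_add _ _ hm, h1, h2, Set.inter_comm,
    Measure.restrict_inter_add_sdiff B hA]

/-- A transport map between nearby convex regions that moves few points by a long distance. -/
theorem exists_transport_of_near (hn : 0 < n) {P Q : Region n} (hP : Convex ℝ P.carrier)
    (h0 : 0 ∈ P.carrier) {R : ℝ} (hPR : P.carrier ⊆ Metric.closedBall 0 R) {η : ℝ} (hη : 0 < η)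
    (hη' : η ≤ 1 / 2) (h : Near η P.carrier Q.carrier) :
    ∃ (γ : E n → E n) (B : Set (E n)), Measurable γ ∧ (uniformDist P).map γ = uniformDist Q ∧
      MeasurableSet B ∧ uniformDist P B ≤ (volume Q.carrier)⁻¹ * volume (shell η P.carrier) ∧
      ∀ᵐ x ∂uniformDist P, dist x (γ x) ≤ 3 * R ∧ (x ∉ B → dist x (γ x) ≤ η * R) := by
  -- Positive dimension makes Lebesgue measure atomless.
  have : Nonempty (Fin n) := ⟨⟨0, hn⟩⟩
  have hR : 0 ≤ R := by simpa using hPR h0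
  obtain ⟨l, hl1, hl2, hl⟩ := exists_volume_image_smul_eq hη (by linarith) h
  have hl0 : 0 < l := by linarith
  have hlm : Measurable fun x : E n => l • x := measurable_const_smul l
  have hDm : MeasurableSet ((fun x => l • x) '' P.carrier) :=
    (isOpen_image_smul P.isOpen hl0.ne').measurableSet
  have hQm := Q.isOpen.measurableSet
  have hfin : volume ((fun x => l • x) '' P.carrier) ≠ ∞ := hl ▸ volume_carrier_ne_top Q
  obtain ⟨T, hT, hTm, hTid⟩ :=
    exists_map_restrict_eq_of_measure_eq (volume : Measure (E n)) hDm hQm hl hfin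
  have hmap : (uniformDist P).map (fun x => T (l • x)) = uniformDist Q := by
    change (uniformDist P).map (T ∘ fun x => l • x) = uniformDist Q
    rw [← Measure.map_map hT hlm, map_smul_uniformDist P hl0, uniformDist,
      ProbabilityTheory.cond, ProbabilityTheory.cond, Measure.map_smul, hTm, hl]
  -- `B` holds the points whose dilate misses `Q`; elsewhere `T` is the identity and only the
  -- dilation moves the point.
  refine ⟨fun x => T (l • x), (fun x => l • x) ⁻¹' ((fun x => l • x) '' P.carrier \ Q.carrier),
    hT.comp hlm, hmap, hlm (hDm.diff hQm), ?_, ?_⟩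
  · rw [← Measure.map_apply hlm (hDm.diff hQm), map_smul_uniformDist P hl0,
      ProbabilityTheory.cond_apply hDm, hl]
    gcongr
    refine Set.inter_subset_right.trans (Set.sdiff_subset_sdiff ?_ h.1)
    exact image_smul_subset_image_smul hP h0 hl0.le hl2
  · have hae : ∀ᵐ x ∂uniformDist P, T (l • x) ∈ Q.carrier := by
      refine ae_of_ae_map (f := fun x => T (l • x)) (hT.comp hlm).aemeasurable ?_
      rw [hmap]
      exact ae_mem_uniformDist Q
    filter_upwards [hae, ae_mem_uniformDist P] with x hxQ hxP
    have hx := mem_closedBall_zero_iff.1 (hPR hxP)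
    constructor
    · obtain ⟨p, hp, hpx⟩ := h.2 hxQ
      have hpR := mem_closedBall_zero_iff.1 (hPR hp)
      have h1 : ‖T (l • x)‖ ≤ 2 * R := by
        rw [← hpx, norm_smul, Real.norm_of_nonneg (by linarith)]
        exact mul_le_mul (by linarith) hpR (norm_nonneg p) zero_le_two
      calc dist x (T (l • x)) ≤ ‖x‖ + ‖T (l • x)‖ := dist_le_norm_add_norm _ _
        _ ≤ 3 * R := by linarith
    · intro hxB
      rw [hTid _ hxB, dist_comm, dist_eq_norm, show l • x - x = (l - 1) • x by
        rw [sub_smul, one_smul], norm_smul, Real.norm_eq_abs]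
      exact mul_le_mul (abs_le.2 ⟨by linarith, by linarith⟩) hx (norm_nonneg x) hη.le

/-- Points outside `B` cost at most `ψ s` each and the total mass is 1; points of `B` cost at most
`ψ t`. -/
theorem transportCost_le {ψ : ℝ≥0 → ℝ≥0} (hψ : IsMulholland ψ) (θ : Measure (E n))
    [IsProbabilityMeasure θ] {γ : E n → E n} {B : Set (E n)} (hB : MeasurableSet B) {s t : ℝ}
    (h : ∀ᵐ x ∂θ, dist x (γ x) ≤ t ∧ (x ∉ B → dist x (γ x) ≤ s)) :
    transportCost ψ θ γ ≤ ψ s.toNNReal + ψ t.toNNReal * θ B := by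
  have hmono : ∀ (x : E n) (u : ℝ), dist x (γ x) ≤ u →
      (ψ (nndist x (γ x)) : ℝ≥0∞) ≤ ψ u.toNNReal := fun x u hu => by
    refine ENNReal.coe_le_coe.2 (hψ.strictMono.monotone ?_)
    rw [← NNReal.coe_le_coe, coe_nndist]
    exact hu.trans (Real.le_coe_toNNReal u)
  calc transportCost ψ θ γ
      ≤ ∫⁻ x, (ψ s.toNNReal + B.indicator (fun _ => (ψ t.toNNReal : ℝ≥0∞)) x) ∂θ := by
        refine lintegral_mono_ae ?_
        filter_upwards [h] with x hx
        by_cases hxB : x ∈ B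
        · rw [Set.indicator_of_mem hxB]
          exact (hmono x t hx.1).trans le_add_self
        · exact (hmono x s (hx.2 hxB)).trans le_self_add
    _ = ψ s.toNNReal + ψ t.toNNReal * θ B := by
        rw [lintegral_add_left measurable_const, lintegral_const, measure_univ, mul_one,
          lintegral_indicator_const hB]

theorem exists_near_imp_wasserstein_lt (hn : 0 < n) {ψ : ℝ≥0 → ℝ≥0} (hψ : IsMulholland ψ)
    (P : Region n) (hP : Convex ℝ P.carrier) (h0 : 0 ∈ P.carrier) (ε : ℝ≥0∞) (hε : 0 < ε) :
    ∃ η : ℝ, 0 < η ∧ η ≤ 1 / 2 ∧ ∀ Q : Region n, Convex ℝ Q.carrier →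
      Near η P.carrier Q.carrier → wasserstein ψ P Q < ε := by
  obtain ⟨R, hR, hPR⟩ := exists_carrier_subset_closedBall P
  obtain ⟨e, he, he'⟩ := ENNReal.lt_iff_exists_nnreal_btwn.1 hε
  -- As `η ≤ 1/2`, every near `Q` contains `H`; this bounds the factor `(volume Q)⁻¹` independently
  -- of `Q`.
  set H := (fun x => (1 / 2 : ℝ) • x) '' P.carrier with hH
  set C := (ψ (3 * R).toNNReal : ℝ≥0∞) * ((volume H)⁻¹ * volume P.carrier) with hC
  have hHv : volume H ≠ 0 := by
    rw [hH, volume_image_smul (by norm_num)]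
    exact mul_ne_zero (ENNReal.ofReal_pos.2 (by positivity)).ne' (volume_carrier_ne_zero P)
  have hCtop : C ≠ ∞ := ENNReal.mul_ne_top ENNReal.coe_ne_top
    (ENNReal.mul_ne_top (ENNReal.inv_ne_top.2 hHv) (volume_carrier_ne_top P))
  have ht : Filter.Tendsto (fun η : ℝ => (ψ (η * R).toNNReal : ℝ≥0∞) +
      ENNReal.ofReal ((1 + η) ^ n - (1 - η) ^ n) * C) (𝓝 0) (𝓝 0) := by
    have h1 : Continuous fun η : ℝ => (ψ (η * R).toNNReal : ℝ≥0∞) :=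
      ENNReal.continuous_coe.comp (hψ.continuous.comp
        (continuous_real_toNNReal.comp (by fun_prop)))
    have h2 := ENNReal.Tendsto.mul_const (b := C)
        (ENNReal.tendsto_ofReal (tendsto_pow_sub_pow (n := n))) (Or.inr hCtop)
    have h3 := (h1.tendsto 0).add h2
    simpa [hψ.map_zero] using h3
  obtain ⟨η, hη, hη', hlt⟩ := exists_pos_lt_of_tendsto ht
    (ENNReal.coe_pos.2 (hψ.pos (ENNReal.coe_pos.1 he)))
  refine ⟨η, hη, hη', fun Q hQ hnear => ?_⟩
  obtain ⟨γ, B, hγ, hm, hB, hBv, hd⟩ := exists_transport_of_near hn hP h0 hPR hη hη' hnear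
  refine lt_of_le_of_lt (iInf₂_le γ ⟨hγ, hm⟩) (lt_trans (hψ.psiInv_lt_iff.2 ?_) he')
  refine lt_of_le_of_lt ((transportCost_le hψ _ hB hd).trans ?_) hlt
  gcongr _ + ?_
  have hHQ : volume H ≤ volume Q.carrier := measure_mono
    ((image_smul_subset_image_smul hP h0 (by norm_num) (by linarith)).trans hnear.1)
  calc (ψ (3 * R).toNNReal : ℝ≥0∞) * uniformDist P B
      ≤ ψ (3 * R).toNNReal * ((volume H)⁻¹ * volume (shell η P.carrier)) := by
        gcongr
        exact hBv.trans (by gcongr)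
    _ = ENNReal.ofReal ((1 + η) ^ n - (1 - η) ^ n) * C := by
        rw [volume_shell P hP h0 hη.le (by linarith), hC]
        ring

theorem isNearCompatible_wasserstein (hn : 0 < n) {ψ : ℝ≥0 → ℝ≥0} (hψ : IsMulholland ψ) :
    IsNearCompatible (n := n) (wasserstein ψ) where
  shift_eq := wasserstein_shift ψ
  near_of_lt := exists_wasserstein_lt_imp_near hψ
  lt_of_near := exists_near_imp_wasserstein_lt hn hψ

end Shape

/-! ### The topologies coincide -/

theorem mainTheorem2 (n : ℕ) (hn : 2 ≤ n) :
    Shape.convexTopology (n := n) Shape.homeoDist = Shape.convexTopology Shape.hausdorff ∧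
    Shape.convexTopology (n := n) Shape.dualHausdorff = Shape.convexTopology Shape.hausdorff ∧
    Shape.convexTopology (n := n) Shape.symmDiffDist = Shape.convexTopology Shape.hausdorff ∧
    ∀ ψ : ℝ≥0 → ℝ≥0, Shape.IsMulholland ψ →
      Shape.convexTopology (n := n) (Shape.wasserstein ψ) =
        Shape.convexTopology Shape.hausdorff ∧
      ∀ (P : Shape.ConvexRegion n) (r : ℝ≥0∞), 0 < r →
        {Q : Shape.ConvexRegion n | Shape.wasserstein ψ P.1 Q.1 < r} ∈
          @nhds _ (Shape.convexTopology (Shape.wasserstein ψ)) P := by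
  have hH := Shape.isNearCompatible_hausdorff (n := n)
  refine ⟨Shape.isNearCompatible_homeoDist.convexTopology_eq hH,
    Shape.isNearCompatible_dualHausdorff.convexTopology_eq hH,
    Shape.isNearCompatible_symmDiffDist.convexTopology_eq hH, fun ψ hψ => ?_⟩
  have hW := Shape.isNearCompatible_wasserstein (n := n) (by omega) hψ
  exact ⟨hW.convexTopology_eq hH, fun P r hr => hW.setOf_lt_mem_nhds hH P hr⟩
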